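/- Let $\mathcal B$ be a separable Banach space and $\mu_0$ a centered Gaussian Borel measure on $\mathcal B$, with Cameron–Martin norm $\|z\|_{\mu_0}=\sup\{|L(z)| : L\in\mathcal B^*,\ \int L^2\,d\mu_0\le 1\}\in[0,\infty]$ and Cameron–Martin space $\mathcal H_{\mu_0}=\{z\in\mathcal B:\|z\|_{\mu_0}<\infty\}$. For $\varepsilon>0$ let $\mu_0^\varepsilon(A)=\mu_0(\varepsilon^{-1}A)$ for Borel $A\subset\mathcal B$. Let $n\ge 0$ and, for $\varepsilon>0$, let $F^\varepsilon:\mathcal B\to\mathbb R$ have the expansion $$F^\varepsilon(y)=\sum_{i=0}^{n}\frac{\varepsilon^i}{i!}F_i(y)+\varepsilon^n R_n(\varepsilon,y),\qquad y\in\mathcal B,$$ with Borel measurable functions $F_i,\,R_n(\varepsilon,\cdot):\mathcal B\to\mathbb R$ such that $\lim_{\varepsilon\to0^+}R_n(\varepsilon,y)=0$ for every $y\in\mathcal B$ and $F_0$ is continuous. Suppose that for every $0\le i\le n$ there is $\gamma_i>0$ with $$\limsup_{\varepsilon\to0^+}\varepsilon^2\log E_{\mu_0^\varepsilon}\left[\exp\left(\gamma_i\frac{\max\{|F_i(y)|,|R_n(\varepsilon,y)|\}}{\varepsilon^2}\right)\right]<\infty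 .$$ Let $\varepsilon>0$ be such that $F^\varepsilon$ is continuous on $\mathcal B$ and $E_{\mu_0^\varepsilon}[\exp(-F^\varepsilon/\varepsilon^2)]<\infty$, and define the probability measure $$\mu^\varepsilon=\frac{1}{E_{\mu_0^\varepsilon}\left[\exp\left(-\frac1{\varepsilon^2}F^\varepsilon\right)\right]}\exp\left(-\frac1{\varepsilon^2}F^\varepsilon\right)\mu_0^\varepsilon .$$ Then the Onsager–Machlup function of $\mu^\varepsilon$ exists and is equal, up to an additive constant, to $$\operatorname{OM}_{\mu^\varepsilon}(z)=\begin{cases}\frac1{\varepsilon^2}F^\varepsilon(z)+\frac1{2\varepsilon^2}\|z\|_{\mu_0}^2&\text{if }z\in\mathcal H_{\mu_0},\\ +\infty&\text{otherwise.}\end{cases}$$ Here a function $\operatorname{OM}:\mathcal B\to[-\infty,\infty]$, finite at some point, is an Onsager–Machlup function of $\mu$ if, with $B_r(z)$ the open ball of radius $r$ about $z$, $$\lim_{r\to0^+}\frac{\mu(B_r(z_1))}{\mu(B_r(z_2))}=\exp\left(\operatorname{OM}(z_2)-\operatorname{OM}(z_1)\right)\in[0,\infty]$$ for all $z_1,z_2\in\mathcal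 B$ for which the difference on the right is defined, i.e. is not of the form $\infty-\infty$ or $(-\infty)-(-\infty)$. -/

import Mathlib

open MeasureTheory ProbabilityTheory Filter Topology
open scoped ENNReal

/-- The image of `μ` under `x ↦ ε x`; for `ε > 0` this is `A ↦ μ (ε⁻¹ A)`. -/
noncomputable def scaledMeasure {B : Type*} [NormedAddCommGroup B] [NormedSpace ℝ B]
    [MeasurableSpace B] (μ : Measure B) (ε : ℝ) : Measure B :=
  μ.map (fun x => ε • x)

/-- The Cameron–Martin norm of `h` for a centered Gaussian measure `μ`, with values in `[0, ∞]`: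
the supremum of `|L h|` over the continuous linear functionals `L` with `∫ L² dμ ≤ 1`. -/
noncomputable def cameronMartinNorm {B : Type*} [NormedAddCommGroup B] [NormedSpace ℝ B]
    [MeasurableSpace B] (μ : Measure B) (h : B) : ℝ≥0∞ :=
  ⨆ (L : StrongDual ℝ B) (_ : ∫⁻ x, ‖L x‖ₑ ^ 2 ∂μ ≤ 1), ‖L h‖ₑ

/-- The Cameron–Martin space: the vectors of finite Cameron–Martin norm. -/
def cameronMartinSpace {B : Type*} [NormedAddCommGroup B] [NormedSpace ℝ B]
    [MeasurableSpace B] (μ : Measure B) : Set B :=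
  {h | cameronMartinNorm μ h < ⊤}

/-- `OM` is an Onsager–Machlup function of `μ`: for all `z₁`, `z₂`,
`μ (B_r z₁) / μ (B_r z₂) → exp (OM z₂ - OM z₁)` in `[0, ∞]` as `r → 0+`,
whenever the difference on the right is defined, that is, not of the form `∞ - ∞` or
`(-∞) - (-∞)`; and `OM` is finite at some point. -/
def IsOnsagerMachlup {X : Type*} [PseudoMetricSpace X] [MeasurableSpace X]
    (μ : Measure X) (OM : X → EReal) : Prop :=
  (∃ z, OM z ≠ ⊤ ∧ OM z ≠ ⊥) ∧
  ∀ z₁ z₂ : X, ¬ (OM z₁ = ⊤ ∧ OM z₂ = ⊤) → ¬ (OM z₁ = ⊥ ∧ OM z₂ = ⊥) →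
    Tendsto (fun r : ℝ => μ (Metric.ball z₁ r) / μ (Metric.ball z₂ r)) (𝓝[>] 0)
      (𝓝 (EReal.exp (OM z₂ - OM z₁)))

/-- `limsup_{ε → 0+} ε² log E_{μ₀^ε} [exp (γ max {|G|, |R ε|} / ε²)] < ∞`, where the expectation
takes values in `[0, ∞]` and the logarithm and the limsup in `[-∞, ∞]`. -/
def ExpMomentBound {B : Type*} [NormedAddCommGroup B] [NormedSpace ℝ B]
    [MeasurableSpace B] (μ₀ : Measure B) (γ : ℝ) (G : B → ℝ) (R : ℝ → B → ℝ) : Prop :=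
  limsup (fun ε : ℝ => ((ε ^ 2 : ℝ) : EReal) * ENNReal.log
    (∫⁻ y, ENNReal.ofReal (Real.exp (γ * (max |G y| |R ε y| / ε ^ 2))) ∂(scaledMeasure μ₀ ε)))
    (𝓝[>] 0) < ⊤

open Classical in
/-- The extended-real function equal to `f` on `S` and to `+∞` off `S`. -/
noncomputable def extendTop {X : Type*} (S : Set X) (f : X → ℝ) (z : X) : EReal :=
  if z ∈ S then (f z : EReal) else ⊤

/-!
Multiplication by `ε` maps `μ₀` to a centered Gaussian measure `ν`, whose Cameron–Martin norm is
`ε⁻¹` times that of `μ₀`. The measure under study has a continuous positive density with respect to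
`ν`, so the quotient of its value at a small ball around `z` by the value of `ν` tends to the density
at `z` (`tendsto_setLIntegral_ball_div`). All that is needed is the small ball asymptotics of `ν`:
writing `‖z‖` for the Cameron–Martin norm,
`ν (ball z r) / ν (ball 0 r) → exp (-‖z‖² / 2)` as `r → 0+`, with limit `0` if `‖z‖ = ∞`
(`tendsto_measure_ball_div`, `tendsto_measure_ball_div_zero`).

Both bounds rest on the Cameron–Martin formula for the shift by `h = ∫ L(x) x dν`, where `L` is a
continuous linear functional: the translated measure has density `exp (L - ∫ L² / 2)`
(`map_add_covarianceVector`).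

* Upper bound. On a small ball around `z` this density is nearly `exp (L z - ∫ L² / 2)`, so that
  `ν (ball z r)` is at most about `exp (-L z + ∫ L² / 2) * ν (ball (z - h) r)`, and the last factor is
  at most `ν (ball 0 r)` by Anderson's inequality (`measure_ball_le`). For `∫ L² ≤ 1`, the multiple
  `(L z) • L` gives `exp (-(L z)² / 2)`, and the supremum over `L` gives the bound. This includes the
  case `‖z‖ = ∞`.
* Lower bound. For `z = h` the symmetry of `ν` replaces the density on `ball 0 r` by
  `exp (-∫ L² / 2) * cosh L`, and `cosh L ≥ 1`. By the Hahn–Banach theorem every `z` with `‖z‖ ≤ c` is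
  a limit in norm of such `h` with `∫ L² ≤ c²` (`mem_closure_covarianceVector`).

Anderson's inequality is derived from the Prékopa–Leindler inequality at the midpoint. This holds for
the standard Gaussian measure on the line, passes to products and to linear images, and so holds for
all centered Gaussian measures on `ℝᴺ`; a ball of a separable Banach space is, up to monotone limits,
a finite intersection of slabs.
-/

/-! ### The one-dimensional Brunn–Minkowski and Prékopa–Leindler inequalities -/

/-- The Brunn–Minkowski inequality on the line, for compact sets. -/
theorem volume_add_volume_le_of_isCompact {K K' D : Set ℝ} (hK : IsCompact K) (hK' : IsCompact K')
    (hne : K.Nonempty) (hne' : K'.Nonempty) (h : ∀ x ∈ K, ∀ y ∈ K', x + y ∈ D) :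
    volume K + volume K' ≤ volume D := by
  obtain ⟨a, haK, ha⟩ := hK.exists_isGreatest hne
  obtain ⟨b, hbK, hb⟩ := hK'.exists_isLeast hne'
  have h1 : volume ((fun x => x + b) '' K) = volume K := by
    simp [Set.image_add_right, measure_preimage_add_right]
  have h2 : volume ((fun y => a + y) '' K') = volume K' := by
    simp [Set.image_add_left, measure_preimage_add]
  -- the translates `K + b` and `a + K'` of `K` and `K'` meet only in the point `a + b`
  have hdisj : AEDisjoint volume ((fun x => x + b) '' K) ((fun y => a + y) '' K') := by
    refine measure_mono_null (t := {a + b}) ?_ (by simp)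
    rintro z ⟨⟨x, hx, rfl⟩, ⟨y, hy, hxy⟩⟩
    have := ha hx
    have := hb hy
    simp only [Set.mem_singleton_iff] at *
    linarith
  have hmeas : NullMeasurableSet ((fun y => a + y) '' K') volume :=
    (hK'.image (by fun_prop)).measurableSet.nullMeasurableSet
  rw [← h1, ← h2, ← measure_union₀ hmeas hdisj]
  refine measure_mono (Set.union_subset ?_ ?_)
  · rintro _ ⟨x, hx, rfl⟩
    exact h x hx b hbK
  · rintro _ ⟨y, hy, rfl⟩
    exact h a haK y hy

/-- The Brunn–Minkowski inequality on the line. -/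
theorem volume_add_volume_le {A B D : Set ℝ} (hA : MeasurableSet A) (hB : MeasurableSet B)
    (hne : A.Nonempty) (hne' : B.Nonempty) (h : ∀ x ∈ A, ∀ y ∈ B, x + y ∈ D) :
    volume A + volume B ≤ volume D := by
  obtain ⟨a, ha⟩ := hne
  obtain ⟨b, hb⟩ := hne'
  have hsup : ∀ S : Set ℝ, MeasurableSet S →
      volume S = ⨆ (K : Set ℝ) (_ : K ⊆ S ∧ IsCompact K), volume K := fun S hS => by
    rw [hS.measure_eq_iSup_isCompact]
    simp only [iSup_and]
  rw [hsup A hA, hsup B hB]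
  refine ENNReal.biSup_add_biSup_le' ⟨∅, by simp⟩ ⟨∅, by simp⟩ fun K hK K' hK' => ?_
  calc volume K + volume K' ≤ volume (insert a K) + volume (insert b K') :=
        add_le_add (measure_mono (Set.subset_insert _ _)) (measure_mono (Set.subset_insert _ _))
    _ ≤ volume D := volume_add_volume_le_of_isCompact (hK.2.insert a) (hK'.2.insert b)
        (Set.insert_nonempty _ _) (Set.insert_nonempty _ _)
        fun x hx y hy => h x (Set.insert_subset ha hK.1 hx) y (Set.insert_subset hb hK'.1 hy)

/-- The Prékopa–Leindler inequality, in its additive form, for functions of supremum one: apply the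
Brunn–Minkowski inequality to the superlevel sets. -/
theorem lintegral_add_lintegral_le_two_mul {f g h : ℝ → ℝ} (hf : Measurable f) (hg : Measurable g)
    (hh : Measurable h) (hf0 : ∀ x, 0 ≤ f x) (hg0 : ∀ x, 0 ≤ g x) (hh0 : ∀ x, 0 ≤ h x)
    (hf1 : ∀ x, f x ≤ 1) (hg1 : ∀ x, g x ≤ 1)
    (hfs : ∀ t < 1, ∃ x, t < f x) (hgs : ∀ t < 1, ∃ x, t < g x)
    (hfg : ∀ x y, f x * g y ≤ h ((2 : ℝ)⁻¹ • (x + y)) ^ 2) :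
    (∫⁻ x, ENNReal.ofReal (f x)) + ∫⁻ x, ENNReal.ofReal (g x)
      ≤ 2 * ∫⁻ x, ENNReal.ofReal (h x) := by
  rw [lintegral_eq_lintegral_meas_lt volume (ae_of_all _ hf0) hf.aemeasurable,
    lintegral_eq_lintegral_meas_lt volume (ae_of_all _ hg0) hg.aemeasurable,
    lintegral_eq_lintegral_meas_lt volume (ae_of_all _ hh0) hh.aemeasurable]
  have hanti : ∀ u : ℝ → ℝ, Measurable fun t => volume {a | t < u a} := fun u =>
    (Antitone.measurable fun s t hst => measure_mono fun x (hx : t < u x) => hst.trans_lt hx)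
  rw [← lintegral_add_left (hanti f), ← lintegral_const_mul _ (hanti h)]
  refine setLIntegral_mono (by have := hanti h; fun_prop) fun t ht => ?_
  rcases lt_or_ge t 1 with h1 | h1
  · have key : volume {a | t < f a} + volume {a | t < g a}
        ≤ volume ((fun x => (2 : ℝ)⁻¹ * x) ⁻¹' {a | t < h a}) := by
      refine volume_add_volume_le (measurableSet_lt measurable_const hf)
        (measurableSet_lt measurable_const hg) (hfs t h1) (hgs t h1) fun x hx y hy => ?_
      have ht0 : (0 : ℝ) < t := ht
      have : t ^ 2 < h ((2 : ℝ)⁻¹ • (x + y)) ^ 2 := by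
        refine lt_of_lt_of_le ?_ (hfg x y)
        rw [sq]
        exact mul_lt_mul'' hx hy ht0.le ht0.le
      exact lt_of_pow_lt_pow_left₀ 2 (hh0 _) this
    rw [Real.volume_preimage_mul_left (by norm_num)] at key
    simpa using key
  · have e1 : {a | t < f a} = ∅ := by
      ext x; simpa using (hf1 x).trans h1
    have e2 : {a | t < g a} = ∅ := by
      ext x; simpa using (hg1 x).trans h1
    simp [e1, e2]


theorem ENNReal.four_mul_mul_le_add_sq (p q : ℝ≥0∞) : 4 * (p * q) ≤ (p + q) ^ 2 := by
  by_cases hp : p = ∞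
  · simp [hp]
  by_cases hq : q = ∞
  · simp [hq]
  lift p to NNReal using hp
  lift q to NNReal using hq
  norm_cast
  rw [← NNReal.coe_le_coe]
  push_cast
  nlinarith [sq_nonneg ((p : ℝ) - q)]

/-- The Prékopa–Leindler inequality on the line, at the midpoint and for bounded functions. -/
theorem lintegral_mul_lintegral_le_sq {f g h : ℝ → ℝ} (hf : Measurable f) (hg : Measurable g)
    (hh : Measurable h) (hf0 : ∀ x, 0 ≤ f x) (hg0 : ∀ x, 0 ≤ g x) (hh0 : ∀ x, 0 ≤ h x)
    (hfb : BddAbove (Set.range f)) (hgb : BddAbove (Set.range g))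
    (hfg : ∀ x y, f x * g y ≤ h ((2 : ℝ)⁻¹ • (x + y)) ^ 2) :
    (∫⁻ x, ENNReal.ofReal (f x)) * ∫⁻ x, ENNReal.ofReal (g x)
      ≤ (∫⁻ x, ENNReal.ofReal (h x)) ^ 2 := by
  by_cases hfz : ∀ x, f x = 0
  · simp [hfz]
  by_cases hgz : ∀ x, g x = 0
  · simp [hgz]
  push Not at hfz hgz
  -- normalize the suprema `a` and `b` of `f` and `g` to `1`
  set a := ⨆ x, f x with ha
  set b := ⨆ x, g x with hb
  have ha0 : 0 < a := by
    obtain ⟨x, hx⟩ := hfz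
    exact ((hf0 x).lt_of_ne' hx).trans_le (le_ciSup hfb x)
  have hb0 : 0 < b := by
    obtain ⟨x, hx⟩ := hgz
    exact ((hg0 x).lt_of_ne' hx).trans_le (le_ciSup hgb x)
  have hc0 : 0 < √(a * b) := Real.sqrt_pos.2 (mul_pos ha0 hb0)
  have key := lintegral_add_lintegral_le_two_mul (f := fun x => a⁻¹ * f x)
    (g := fun x => b⁻¹ * g x) (h := fun x => (√(a * b))⁻¹ * h x)
    (by fun_prop) (by fun_prop) (by fun_prop)
    (fun x => mul_nonneg (by positivity) (hf0 x)) (fun x => mul_nonneg (by positivity) (hg0 x))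
    (fun x => mul_nonneg (by positivity) (hh0 x))
    (fun x => by rw [inv_mul_le_iff₀ ha0, mul_one]; exact le_ciSup hfb x)
    (fun x => by rw [inv_mul_le_iff₀ hb0, mul_one]; exact le_ciSup hgb x)
    (fun t ht => by
      obtain ⟨x, hx⟩ := exists_lt_of_lt_ciSup (show a * t < ⨆ x, f x by rw [← ha]; nlinarith)
      exact ⟨x, by rwa [lt_inv_mul_iff₀ ha0]⟩)
    (fun t ht => by
      obtain ⟨x, hx⟩ := exists_lt_of_lt_ciSup (show b * t < ⨆ x, g x by rw [← hb]; nlinarith)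
      exact ⟨x, by rwa [lt_inv_mul_iff₀ hb0]⟩)
    (fun x y => by
      rw [mul_pow, inv_pow, Real.sq_sqrt (by positivity), mul_inv]
      calc a⁻¹ * f x * (b⁻¹ * g y) = a⁻¹ * b⁻¹ * (f x * g y) := by ring
        _ ≤ _ := mul_le_mul_of_nonneg_left (hfg x y) (by positivity))
  have e : ∀ {c : ℝ} {u : ℝ → ℝ}, 0 < c → Measurable u →
      ∫⁻ x, ENNReal.ofReal (c⁻¹ * u x) = ENNReal.ofReal c⁻¹ * ∫⁻ x, ENNReal.ofReal (u x) := by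
    intro c u hc hu
    rw [← lintegral_const_mul _ (by fun_prop)]
    exact lintegral_congr fun x => ENNReal.ofReal_mul (by positivity)
  rw [e ha0 hf, e hb0 hg, e hc0 hh] at key
  have h2 := (ENNReal.four_mul_mul_le_add_sq _ _).trans (pow_le_pow_left₀ zero_le key 2)
  have h3 : ENNReal.ofReal (√(a * b))⁻¹ ^ 2 = ENNReal.ofReal a⁻¹ * ENNReal.ofReal b⁻¹ := by
    rw [← ENNReal.ofReal_pow (by positivity), ← ENNReal.ofReal_mul (by positivity), inv_pow,
      Real.sq_sqrt (by positivity), mul_inv]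
  rw [mul_pow, mul_pow, h3] at h2
  have h4 : (4 * (ENNReal.ofReal a⁻¹ * ENNReal.ofReal b⁻¹)) *
      ((∫⁻ x, ENNReal.ofReal (f x)) * ∫⁻ x, ENNReal.ofReal (g x)) ≤
      (4 * (ENNReal.ofReal a⁻¹ * ENNReal.ofReal b⁻¹)) *
        (∫⁻ x, ENNReal.ofReal (h x)) ^ 2 := by
    calc _ = _ := by ring
      _ ≤ _ := h2
      _ = _ := by ring
  refine (ENNReal.mul_le_mul_iff_right ?_ ?_).1 h4
  · simp [ha0, hb0]
  · finiteness

/-! ### Midpoint log-concave measures -/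

/-- A measure is midpoint log-concave if it satisfies the Prékopa–Leindler inequality at the
midpoint. The inequality is only required of functions with values in `[0, 1]`. -/
def IsMidpointLogConcave {E : Type*} [AddCommGroup E] [Module ℝ E] [MeasurableSpace E]
    (μ : Measure E) : Prop :=
  ∀ f g h : E → ℝ≥0∞, Measurable f → Measurable g → Measurable h →
    (∀ x, f x ≤ 1) → (∀ x, g x ≤ 1) → (∀ x, h x ≤ 1) →
    (∀ x y, f x * g y ≤ h ((2 : ℝ)⁻¹ • (x + y)) ^ 2) →
    (∫⁻ x, f x ∂μ) * ∫⁻ x, g x ∂μ ≤ (∫⁻ x, h x ∂μ) ^ 2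

theorem gaussianPDFReal_mul_le_sq (x y : ℝ) :
    gaussianPDFReal 0 1 x * gaussianPDFReal 0 1 y
      ≤ gaussianPDFReal 0 1 ((2 : ℝ)⁻¹ • (x + y)) ^ 2 := by
  simp only [gaussianPDFReal, mul_pow, sub_zero, NNReal.coe_one, mul_one, smul_eq_mul]
  rw [mul_mul_mul_comm, ← sq, ← Real.exp_add, ← Real.exp_nat_mul]
  gcongr
  push_cast
  nlinarith [sq_nonneg (x - y)]

theorem isMidpointLogConcave_gaussianReal : IsMidpointLogConcave (gaussianReal 0 1) := by
  intro f g h hf hg hh hf1 hg1 hh1 hfg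
  have e : ∀ {u : ℝ → ℝ≥0∞}, Measurable u → (∀ x, u x ≤ 1) → ∫⁻ x, u x ∂(gaussianReal 0 1) =
      ∫⁻ x, ENNReal.ofReal (gaussianPDFReal 0 1 x * (u x).toReal) := by
    intro u hu hu1
    rw [gaussianReal_of_var_ne_zero 0 one_ne_zero,
      lintegral_withDensity_eq_lintegral_mul _ (measurable_gaussianPDF 0 1) hu]
    refine lintegral_congr fun x => ?_
    rw [ENNReal.ofReal_mul (gaussianPDFReal_nonneg _ _ _),
      ENNReal.ofReal_toReal ((hu1 x).trans_lt ENNReal.one_lt_top).ne]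
    rfl
  have hb : ∀ {u : ℝ → ℝ≥0∞}, (∀ x, u x ≤ 1) →
      BddAbove (Set.range fun x => gaussianPDFReal 0 1 x * (u x).toReal) := by
    intro u hu1
    refine ⟨(√(2 * Real.pi * (1 : NNReal)))⁻¹ * 1 * 1, ?_⟩
    rintro _ ⟨x, rfl⟩
    have h1 : (u x).toReal ≤ 1 := ENNReal.toReal_le_of_le_ofReal zero_le_one (by simpa using hu1 x)
    simp only [gaussianPDFReal]
    gcongr
    exact Real.exp_le_one_iff.2 (div_nonpos_of_nonpos_of_nonneg (by nlinarith [sq_nonneg x])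
      (by positivity))
  rw [e hf hf1, e hg hg1, e hh hh1]
  refine lintegral_mul_lintegral_le_sq (by fun_prop) (by fun_prop) (by fun_prop)
    (fun x => mul_nonneg (gaussianPDFReal_nonneg _ _ _) ENNReal.toReal_nonneg)
    (fun x => mul_nonneg (gaussianPDFReal_nonneg _ _ _) ENNReal.toReal_nonneg)
    (fun x => mul_nonneg (gaussianPDFReal_nonneg _ _ _) ENNReal.toReal_nonneg)
    (hb hf1) (hb hg1) fun x y => ?_
  rw [mul_mul_mul_comm, mul_pow]
  refine mul_le_mul (gaussianPDFReal_mul_le_sq x y) ?_ (by positivity) (by positivity)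
  rw [← ENNReal.toReal_mul, ← ENNReal.toReal_pow]
  refine ENNReal.toReal_mono ?_ (hfg x y)
  exact ENNReal.pow_ne_top ((hh1 _).trans_lt ENNReal.one_lt_top).ne

/-- Fubini's theorem: integrate first over the second factor, then over the first. -/
theorem IsMidpointLogConcave.prod {E F : Type*} [AddCommGroup E] [Module ℝ E] [MeasurableSpace E]
    [AddCommGroup F] [Module ℝ F] [MeasurableSpace F] {μ : Measure E} {ν : Measure F}
    [SFinite μ] [IsProbabilityMeasure ν]
    (hμ : IsMidpointLogConcave μ) (hν : IsMidpointLogConcave ν) :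
    IsMidpointLogConcave (μ.prod ν) := by
  intro f g h hf hg hh hf1 hg1 hh1 hfg
  rw [lintegral_prod _ hf.aemeasurable, lintegral_prod _ hg.aemeasurable,
    lintegral_prod _ hh.aemeasurable]
  have hle : ∀ {u : E × F → ℝ≥0∞}, (∀ x, u x ≤ 1) → ∀ x, ∫⁻ y, u (x, y) ∂ν ≤ 1 :=
    fun hu x => (lintegral_mono fun y => hu (x, y)).trans (by simp)
  refine hμ _ _ _ hf.lintegral_prod_right' hg.lintegral_prod_right' hh.lintegral_prod_right'
    (hle hf1) (hle hg1) (hle hh1) fun x y => ?_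
  exact hν _ _ _ (hf.comp measurable_prodMk_left) (hg.comp measurable_prodMk_left)
    (hh.comp measurable_prodMk_left) (fun _ => hf1 _) (fun _ => hg1 _) (fun _ => hh1 _)
    fun x' y' => hfg (x, x') (y, y')

theorem IsMidpointLogConcave.map {E F : Type*} [AddCommGroup E] [Module ℝ E] [MeasurableSpace E]
    [AddCommGroup F] [Module ℝ F] [MeasurableSpace F] {μ : Measure E}
    (hμ : IsMidpointLogConcave μ) {A : E →ₗ[ℝ] F} (hA : Measurable A) :
    IsMidpointLogConcave (μ.map A) := by
  intro f g h hf hg hh hf1 hg1 hh1 hfg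
  rw [lintegral_map hf hA, lintegral_map hg hA, lintegral_map hh hA]
  refine hμ _ _ _ (hf.comp hA) (hg.comp hA) (hh.comp hA) (fun _ => hf1 _) (fun _ => hg1 _)
    (fun _ => hh1 _) fun x y => ?_
  simpa using hfg (A x) (A y)

theorem isMidpointLogConcave_pi_gaussianReal (N : ℕ) :
    IsMidpointLogConcave (Measure.pi fun _ : Fin N => gaussianReal 0 1) := by
  induction N with
  | zero =>
    intro f g h hf hg hh hf1 hg1 hh1 hfg
    have e : ∀ u : (Fin 0 → ℝ) → ℝ≥0∞, u = fun _ => u 0 := fun u =>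
      funext fun x => congrArg u (Subsingleton.elim x 0)
    rw [e f, e g, e h]
    simpa using hfg 0 0
  | succ N ih =>
    have hmp := (measurePreserving_piFinSuccAbove
      (fun _ : Fin (N + 1) => gaussianReal 0 1) 0).symm.map_eq
    let A : ℝ × (Fin N → ℝ) →ₗ[ℝ] (Fin (N + 1) → ℝ) := (Fin.consLinearEquiv ℝ fun _ => ℝ).toLinearMap
    have hA : ⇑A = (MeasurableEquiv.piFinSuccAbove (fun _ : Fin (N + 1) => ℝ) 0).symm := by
      ext x i
      simp [A, MeasurableEquiv.piFinSuccAbove, Fin.insertNthEquiv]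
    rw [← hmp, ← hA]
    exact (isMidpointLogConcave_gaussianReal.prod ih).map (by rw [hA]; fun_prop)

theorem IsMidpointLogConcave.measure_mul_measure_le {E : Type*} [AddCommGroup E] [Module ℝ E]
    [MeasurableSpace E] {μ : Measure E} (hμ : IsMidpointLogConcave μ) {S T K : Set E}
    (hS : MeasurableSet S) (hT : MeasurableSet T) (hK : MeasurableSet K)
    (h : ∀ x ∈ S, ∀ y ∈ T, (2 : ℝ)⁻¹ • (x + y) ∈ K) : μ S * μ T ≤ μ K ^ 2 := by
  have h1 : ∀ (U : Set E) (x : E), U.indicator (1 : E → ℝ≥0∞) x ≤ 1 := fun U =>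
    Set.indicator_le_self' (fun _ _ => zero_le)
  have := hμ (S.indicator 1) (T.indicator 1) (K.indicator 1) (measurable_one.indicator hS)
    (measurable_one.indicator hT) (measurable_one.indicator hK) (h1 S) (h1 T) (h1 K) ?_
  · simpa [lintegral_indicator_one, hS, hT, hK] using this
  · intro x y
    by_cases hx : x ∈ S
    · by_cases hy : y ∈ T
      · rw [Set.indicator_of_mem (h x hx y hy)]
        simp [hx, hy]
      · simp [hy]
    · simp [hx]

/-! ### Anderson's inequality for balls -/

open scoped MatrixOrder in
theorem isMidpointLogConcave_multivariateGaussian {N : ℕ} (S : Matrix (Fin N) (Fin N) ℝ) :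
    IsMidpointLogConcave (multivariateGaussian 0 S) := by
  let E := EuclideanSpace ℝ (Fin N)
  let T : (Fin (Module.finrank ℝ E) → ℝ) →ₗ[ℝ] E :=
    (Fintype.linearCombination ℝ (stdOrthonormalBasis ℝ E))
  have hstd : IsMidpointLogConcave (stdGaussian E) := by
    have : ⇑T = fun x : Fin (Module.finrank ℝ E) → ℝ => ∑ i, x i • stdOrthonormalBasis ℝ E i := by
      ext1 x
      simp [T, Fintype.linearCombination_apply]
    rw [stdGaussian, ← this]
    exact (isMidpointLogConcave_pi_gaussianReal _).map (by rw [this]; fun_prop)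
  have := hstd.map (A := (Matrix.toEuclideanCLM (𝕜 := ℝ) (CFC.sqrt S)).toLinearMap)
    (Matrix.toEuclideanCLM (𝕜 := ℝ) (CFC.sqrt S)).measurable
  simpa [multivariateGaussian] using this

open scoped MatrixOrder in
/-- A centered Gaussian measure on `ℝᴺ` is the image of the standard one under the square root of
its covariance matrix. -/
theorem isMidpointLogConcave_of_isGaussian {N : ℕ} (γ : Measure (EuclideanSpace ℝ (Fin N)))
    [IsGaussian γ] (hγ : ∫ x, x ∂γ = 0) : IsMidpointLogConcave γ := by
  let b := EuclideanSpace.basisFun (Fin N) ℝ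
  let S : Matrix (Fin N) (Fin N) ℝ := fun i j => covarianceBilin γ (b i) (b j)
  have hS' : ∀ x y : EuclideanSpace ℝ (Fin N),
      x ⬝ᵥ S.mulVec y = covarianceBilin γ x y := by
    intro x y
    conv_rhs => rw [← b.sum_repr x, ← b.sum_repr y]
    simp only [b, S, dotProduct, Matrix.mulVec, EuclideanSpace.basisFun_repr, map_sum, map_smul,
      FunLike.coe_sum, Finset.sum_apply, FunLike.coe_smul, Pi.smul_apply, smul_eq_mul,
      Finset.mul_sum]
    rw [Finset.sum_comm]
    exact Finset.sum_congr rfl fun i _ => Finset.sum_congr rfl fun j _ => by ring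
  have hS : S.PosSemidef := by
    refine Matrix.PosSemidef.of_dotProduct_mulVec_nonneg ?_ fun x => ?_
    · ext i j
      exact covarianceBilin_comm _ _
    · have := hS' (WithLp.toLp 2 x) (WithLp.toLp 2 x)
      simp at this ⊢
      rw [this]
      exact covarianceBilin_self_nonneg _
  have : γ = multivariateGaussian 0 S := by
    refine IsGaussian.ext ?_ ?_
    · simp [hγ]
    · ext x y
      rw [covarianceBilin_multivariateGaussian hS, hS']
  rw [this]
  exact isMidpointLogConcave_multivariateGaussian S

theorem measure_preimage_neg_eq {B : Type*} [NormedAddCommGroup B] [MeasurableSpace B]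
    [BorelSpace B] {ν : Measure B} (hν : ν.map (fun x => -x) = ν) {A : Set B}
    (hA : MeasurableSet A) : ν ((fun x => -x) ⁻¹' A) = ν A := by
  conv_rhs => rw [← hν, Measure.map_apply (by fun_prop) hA]

section

variable {B : Type*} [NormedAddCommGroup B] [NormedSpace ℝ B] [CompleteSpace B]
  [TopologicalSpace.SeparableSpace B] [MeasurableSpace B] [BorelSpace B]

/-- In a separable space the closed balls are intersections of countably many slabs. -/
theorem exists_seq_dual_norm_le_iff (B : Type*) [NormedAddCommGroup B] [NormedSpace ℝ B]
    [TopologicalSpace.SeparableSpace B] :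
    ∃ L : ℕ → StrongDual ℝ B, ∀ (x : B) (r : ℝ), ‖x‖ ≤ r ↔ ∀ n, |L n x| ≤ r := by
  obtain ⟨u, hu⟩ := TopologicalSpace.exists_dense_seq B
  choose L hL1 hL using fun n => exists_dual_vector'' ℝ (u n)
  refine ⟨L, fun x r => ⟨fun h n => ?_, fun h => ?_⟩⟩
  · exact ((L n).le_of_opNorm_le (hL1 n) x).trans (by simpa using h)
  · refine le_of_forall_pos_le_add fun δ hδ => ?_
    obtain ⟨n, hn⟩ := hu.exists_dist_lt x (half_pos hδ)
    rw [dist_eq_norm] at hn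
    have h1 : |L n (u n - x)| ≤ ‖u n - x‖ := by
      simpa using (L n).le_of_opNorm_le (hL1 n) (u n - x)
    have h2 : L n (u n) = ‖u n‖ := by simpa using hL n
    have h3 := h n
    have h4 : ‖x‖ ≤ ‖x - u n‖ + ‖u n‖ := by simpa using norm_add_le (x - u n) (u n)
    rw [norm_sub_rev] at h1
    rw [map_sub, h2] at h1
    have := abs_le.1 h1
    have := abs_le.1 h3
    linarith

variable {ν : Measure B} [IsGaussian ν]

theorem map_neg_eq_self (hν : ∀ L : StrongDual ℝ B, ∫ x, L x ∂ν = 0) :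
    ν.map (fun x => -x) = ν := by
  refine Measure.ext_of_charFunDual ?_
  ext L
  have hc : ⇑L ∘ (fun x : B => -x) = fun x => -(L x) := by ext; simp
  rw [IsGaussian.charFunDual_eq, IsGaussian.charFunDual_eq,
    variance_map (by fun_prop) (by fun_prop), hc,
    integral_map (by fun_prop) (by fun_prop)]
  have : Var[fun x => -(L x); ν] = Var[L; ν] := variance_neg
  rw [this]
  simp [integral_neg, integral_complex_ofReal, hν]

/-- Anderson's inequality for finite intersections of slabs. The midpoint of a point of the translate
by `w` and a point of the translate by `-w` lies in the centered set, and by symmetry both translates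
have the same measure. -/
theorem measure_cylinder_le (hν : ∀ L : StrongDual ℝ B, ∫ x, L x ∂ν = 0) {N : ℕ}
    (L : Fin N → StrongDual ℝ B) (w : B) (r : ℝ) :
    ν {x | ∀ i, |L i (x - w)| ≤ r} ≤ ν {x | ∀ i, |L i x| ≤ r} := by
  let P : B →L[ℝ] EuclideanSpace ℝ (Fin N) :=
    (PiLp.continuousLinearEquiv 2 ℝ (fun _ : Fin N => ℝ)).symm.toContinuousLinearMap ∘L
      ContinuousLinearMap.pi L
  have hP : ∀ x i, P x i = L i x := fun x i => by simp [P]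
  have hmean : ∫ x, x ∂(ν.map P) = 0 := by
    rw [integral_map (by fun_prop) (by fun_prop), P.integral_comp_comm IsGaussian.integrable_fun_id]
    ext i
    rw [hP, ← (L i).integral_comp_comm IsGaussian.integrable_fun_id]
    simpa using hν (L i)
  have hlc := isMidpointLogConcave_of_isGaussian (ν.map P) hmean
  let K : B → Set (EuclideanSpace ℝ (Fin N)) := fun w => {y | ∀ i, |y i - L i w| ≤ r}
  have hK : ∀ w, MeasurableSet (K w) := fun w => by
    have : K w = ⋂ i, {y | |y i - L i w| ≤ r} := by ext; simp [K]
    rw [this]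
    exact MeasurableSet.iInter fun i => measurableSet_le (by fun_prop) measurable_const
  have key := hlc.measure_mul_measure_le (hK w) (hK (-w)) (hK 0) fun x hx y hy i => by
    have hx := abs_le.1 (hx i)
    have hy := abs_le.1 (hy i)
    simp only [map_neg, map_zero, PiLp.smul_apply, PiLp.add_apply, smul_eq_mul] at *
    exact abs_le.2 ⟨by linarith, by linarith⟩
  rw [Measure.map_apply (by fun_prop) (hK _), Measure.map_apply (by fun_prop) (hK _),
    Measure.map_apply (by fun_prop) (hK _)] at key
  have e1 : P ⁻¹' K w = {x | ∀ i, |L i (x - w)| ≤ r} := by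
    ext x; simp [K, hP]
  have e0 : P ⁻¹' K 0 = {x | ∀ i, |L i x| ≤ r} := by
    ext x; simp [K, hP]
  -- the cylinders centered at `w` and `-w` have the same measure
  have e2 : ν (P ⁻¹' K (-w)) = ν (P ⁻¹' K w) := by
    rw [← measure_preimage_neg_eq (map_neg_eq_self hν) (P.measurable (hK w))]
    congr 1
    ext x
    simp only [K, hP, Set.mem_preimage, Set.mem_ofPred_eq]
    refine forall_congr' fun i => ?_
    rw [← abs_neg, map_neg, map_neg]
    ring_nf
  rw [e2, e1, e0, ← sq] at key
  exact (ENNReal.pow_le_pow_left_iff two_ne_zero).1 key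

theorem measure_closedBall_le (hν : ∀ L : StrongDual ℝ B, ∫ x, L x ∂ν = 0) (w : B) (r : ℝ) :
    ν (Metric.closedBall w r) ≤ ν (Metric.closedBall 0 r) := by
  obtain ⟨L, hL⟩ := exists_seq_dual_norm_le_iff B
  let C : ℕ → Set B := fun N => {x | ∀ i : Fin N, |L i x| ≤ r}
  have hC : ∀ N, MeasurableSet (C N) := fun N => by
    have : C N = ⋂ i : Fin N, {y | |L i y| ≤ r} := by ext; simp [C]
    rw [this]
    exact MeasurableSet.iInter fun i => measurableSet_le (by fun_prop) measurable_const
  have hanti : Antitone C := fun M N h x hx i => hx (Fin.castLE h i)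
  have hball : Metric.closedBall 0 r = ⋂ N, C N := by
    ext x
    simp only [mem_closedBall_zero_iff, hL, Set.mem_iInter, C, Set.mem_ofPred_eq]
    exact ⟨fun h N i => h i, fun h n => h (n + 1) (Fin.last n)⟩
  rw [hball, hanti.measure_iInter (fun N => (hC N).nullMeasurableSet) ⟨0, measure_ne_top _ _⟩]
  refine le_iInf fun N => (measure_mono ?_).trans
    (measure_cylinder_le hν (fun i : Fin N => L i) w r)
  intro x hx i
  rw [mem_closedBall_iff_norm] at hx
  exact (hL _ _).1 hx i

/-- Anderson's inequality: among the balls of a given radius, the one centered at the origin has the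
greatest measure. -/
theorem measure_ball_le (hν : ∀ L : StrongDual ℝ B, ∫ x, L x ∂ν = 0) (w : B) (r : ℝ) :
    ν (Metric.ball w r) ≤ ν (Metric.ball 0 r) := by
  have hU : Metric.ball w r = ⋃ n : ℕ, Metric.closedBall w (r - 1 / ((n : ℝ) + 1)) := by
    ext x
    simp only [Metric.mem_ball, Set.mem_iUnion, Metric.mem_closedBall]
    constructor
    · intro h
      obtain ⟨n, hn⟩ := exists_nat_one_div_lt (sub_pos.2 h)
      exact ⟨n, by linarith⟩
    · rintro ⟨n, hn⟩
      have : (0 : ℝ) < 1 / ((n : ℝ) + 1) := by positivity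
      linarith
  have hmono : Monotone fun n : ℕ => Metric.closedBall w (r - 1 / ((n : ℝ) + 1)) :=
    fun m n h => Metric.closedBall_subset_closedBall
      (sub_le_sub_left (Nat.one_div_le_one_div h) r)
  rw [hU, hmono.measure_iUnion]
  refine iSup_le fun n => (measure_closedBall_le hν w _).trans (measure_mono ?_)
  refine Metric.closedBall_subset_ball ?_
  have : (0 : ℝ) < 1 / ((n : ℝ) + 1) := by positivity
  linarith

/-- The origin is in the support: otherwise, by Anderson's inequality, all balls of some radius would
be null sets, and countably many of them cover the space. -/
theorem measure_ball_zero_pos (hν : ∀ L : StrongDual ℝ B, ∫ x, L x ∂ν = 0) {r : ℝ} (hr : 0 < r) :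
    0 < ν (Metric.ball 0 r) := by
  rw [pos_iff_ne_zero]
  intro h0
  obtain ⟨u, hu⟩ := TopologicalSpace.exists_dense_seq B
  have hcover : (Set.univ : Set B) ⊆ ⋃ n, Metric.ball (u n) r := fun x _ => by
    obtain ⟨n, hn⟩ := hu.exists_dist_lt x hr
    exact Set.mem_iUnion.2 ⟨n, hn⟩
  have : ν Set.univ = 0 := measure_mono_null hcover <| measure_iUnion_null fun n =>
    le_antisymm ((measure_ball_le hν (u n) r).trans h0.le) zero_le
  simp at this

end

/-! ### Continuous linear functionals under a centered Gaussian measure -/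

section

variable {B : Type*} [NormedAddCommGroup B] [NormedSpace ℝ B] [MeasurableSpace B] [BorelSpace B]

variable {ν : Measure B} [IsGaussian ν]

theorem integrable_dual_mul_dual (ν : Measure B) [IsGaussian ν] (L M : StrongDual ℝ B) :
    Integrable (fun x => L x * M x) ν :=
  (IsGaussian.memLp_dual ν L 2 (by simp)).integrable_mul (IsGaussian.memLp_dual ν M 2 (by simp))

theorem integrable_dual_sq (ν : Measure B) [IsGaussian ν] (L : StrongDual ℝ B) :
    Integrable (fun x => L x ^ 2) ν :=
  (IsGaussian.memLp_dual ν L 2 (by simp)).integrable_sq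

theorem map_dual_eq_gaussianReal (hν : ∀ L : StrongDual ℝ B, ∫ x, L x ∂ν = 0)
    (L : StrongDual ℝ B) : ν.map L = gaussianReal 0 (∫ x, L x ^ 2 ∂ν).toNNReal := by
  rw [IsGaussian.map_eq_gaussianReal L, hν L, variance_of_integral_eq_zero (by fun_prop) (hν L)]

theorem integral_sq_add_smul (a b : ℝ) (L M : StrongDual ℝ B) :
    ∫ x, (a • L + b • M) x ^ 2 ∂ν
      = a ^ 2 * ∫ x, L x ^ 2 ∂ν + 2 * a * b * ∫ x, L x * M x ∂ν + b ^ 2 * ∫ x, M x ^ 2 ∂ν := by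
  rw [← integral_const_mul, ← integral_const_mul, ← integral_const_mul,
    ← integral_add ((integrable_dual_sq ν L).const_mul _)
      ((integrable_dual_mul_dual ν L M).const_mul _),
    ← integral_add (((integrable_dual_sq ν L).const_mul _).fun_add
      ((integrable_dual_mul_dual ν L M).const_mul _)) ((integrable_dual_sq ν M).const_mul _)]
  refine integral_congr_ae (ae_of_all _ fun x => ?_)
  simp
  ring

theorem mgf_dual (hν : ∀ L : StrongDual ℝ B, ∫ x, L x ∂ν = 0) (L : StrongDual ℝ B) (t : ℝ) :
    mgf L ν t = Real.exp (t ^ 2 * (∫ x, L x ^ 2 ∂ν) / 2) := by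
  rw [mgf_gaussianReal (map_dual_eq_gaussianReal hν L),
    Real.coe_toNNReal _ (integral_nonneg fun x => sq_nonneg _)]
  ring_nf

theorem integral_exp_dual (hν : ∀ L : StrongDual ℝ B, ∫ x, L x ∂ν = 0) (L : StrongDual ℝ B) :
    ∫ x, Real.exp (L x) ∂ν = Real.exp ((∫ x, L x ^ 2 ∂ν) / 2) := by
  simpa [mgf] using mgf_dual hν L 1

theorem integrable_exp_dual (hν : ∀ L : StrongDual ℝ B, ∫ x, L x ∂ν = 0) (L : StrongDual ℝ B) :
    Integrable (fun x => Real.exp (L x)) ν := by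
  have : 0 < mgf L ν 1 := by rw [mgf_dual hν]; exact Real.exp_pos _
  simpa using mgf_pos_iff.1 this

/-! ### The Cameron–Martin norm -/

theorem lintegral_enorm_sq_eq (ν : Measure B) [IsGaussian ν] (L : StrongDual ℝ B) :
    ∫⁻ x, ‖L x‖ₑ ^ 2 ∂ν = ENNReal.ofReal (∫ x, L x ^ 2 ∂ν) := by
  rw [ofReal_integral_eq_lintegral_ofReal (integrable_dual_sq ν L)
    (ae_of_all _ fun x => sq_nonneg _)]
  refine lintegral_congr fun x => ?_
  rw [Real.enorm_eq_ofReal_abs, ← ENNReal.ofReal_pow (abs_nonneg _), sq_abs]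

theorem cameronMartinNorm_le_ofReal_iff {z : B} {c : ℝ} (hc : 0 ≤ c) :
    cameronMartinNorm ν z ≤ ENNReal.ofReal c ↔
      ∀ L : StrongDual ℝ B, ∫ x, L x ^ 2 ∂ν ≤ 1 → |L z| ≤ c := by
  simp only [cameronMartinNorm, iSup_le_iff, lintegral_enorm_sq_eq, ENNReal.ofReal_le_one]
  simp only [Real.enorm_eq_ofReal_abs, ENNReal.ofReal_le_ofReal_iff hc]

/-- The homogeneous form of the bound that defines the Cameron–Martin norm, which also covers the
functionals of variance zero. -/
theorem abs_dual_le_of_cameronMartinNorm_le {z : B} {c : ℝ} (hc : 0 ≤ c)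
    (hz : cameronMartinNorm ν z ≤ ENNReal.ofReal c) (L : StrongDual ℝ B) :
    |L z| ≤ c * √(∫ x, L x ^ 2 ∂ν) := by
  rw [cameronMartinNorm_le_ofReal_iff hc] at hz
  have hsm : ∀ k : ℝ, ∫ x, (k • L) x ^ 2 ∂ν = k ^ 2 * ∫ x, L x ^ 2 ∂ν := fun k => by
    rw [← integral_const_mul]
    simp [mul_pow]
  set s := ∫ x, L x ^ 2 ∂ν with hs
  have hs0 : 0 ≤ s := integral_nonneg fun x => sq_nonneg _
  rcases hs0.eq_or_lt with h0 | h0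
  · -- all multiples of `L` are admissible in the definition of the norm
    by_contra! hlt
    rw [← h0] at hlt
    simp only [Real.sqrt_zero, mul_zero] at hlt
    have := hz (((c + 1) / |L z|) • L) (by rw [hsm, ← h0]; simp)
    rw [FunLike.coe_smul, Pi.smul_apply, smul_eq_mul, abs_mul, abs_of_nonneg (by positivity),
      div_mul_cancel₀ _ hlt.ne'] at this
    linarith
  · have := hz ((√s)⁻¹ • L) (by
      rw [hsm, inv_pow, Real.sq_sqrt hs0, inv_mul_cancel₀ h0.ne'])
    rw [FunLike.coe_smul, Pi.smul_apply, smul_eq_mul, abs_mul, abs_of_nonneg (by positivity),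
      inv_mul_le_iff₀ (Real.sqrt_pos.2 h0)] at this
    linarith

/-! ### Translates of a Gaussian measure -/

variable [CompleteSpace B] [TopologicalSpace.SeparableSpace B]

/-- The value at `L` of the covariance operator of a centered measure `ν`: the Bochner integral
`∫ L(x) x dν`. It is the vector `h` with `M h = ∫ L M dν` for all functionals `M`. -/
noncomputable def covarianceVector {B : Type*} [NormedAddCommGroup B] [NormedSpace ℝ B]
    [MeasurableSpace B] (ν : Measure B) (L : StrongDual ℝ B) : B :=
  ∫ x, L x • x ∂ν

theorem integrable_dual_smul_id (ν : Measure B) [IsGaussian ν] (L : StrongDual ℝ B) :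
    Integrable (fun x => L x • x) ν := by
  have h := (IsGaussian.memLp_two_id (μ := ν)).smul (IsGaussian.memLp_dual ν L 2 (by simp)) (r := 1)
  exact memLp_one_iff_integrable.1 h

theorem dual_covarianceVector (L M : StrongDual ℝ B) :
    M (covarianceVector ν L) = ∫ x, L x * M x ∂ν := by
  rw [covarianceVector, ← M.integral_comp_comm (integrable_dual_smul_id ν L)]
  simp

theorem covarianceVector_add_smul (a b : ℝ) (L M : StrongDual ℝ B) :
    covarianceVector ν (a • L + b • M) = a • covarianceVector ν L + b • covarianceVector ν M := by
  simp only [covarianceVector]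
  rw [← integral_smul, ← integral_smul,
    ← integral_add ((integrable_dual_smul_id ν L).fun_smul a)
      ((integrable_dual_smul_id ν M).fun_smul b)]
  refine integral_congr_ae (ae_of_all _ fun x => ?_)
  simp [add_smul, mul_smul]

/-- The Cameron–Martin formula for the shift by the covariance vector of a continuous linear
functional. Both sides assign the same moment generating function to every functional. -/
theorem map_add_covarianceVector (hν : ∀ L : StrongDual ℝ B, ∫ x, L x ∂ν = 0)
    (L : StrongDual ℝ B) :
    ν.map (fun x => x + covarianceVector ν L) = ν.tilted L := by
  have hprob : IsProbabilityMeasure (ν.tilted L) :=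
    isProbabilityMeasure_tilted (integrable_exp_dual hν L)
  refine Measure.ext_of_charFunDual ?_
  ext M
  rw [charFunDual_eq_charFun_map_one, charFunDual_eq_charFun_map_one, ← complexMGF_id_mul_I,
    ← complexMGF_id_mul_I, complexMGF_id_map (by fun_prop), complexMGF_id_map (by fun_prop)]
  have hmgf : ∀ t, mgf M (ν.tilted L) t =
      Real.exp (t ^ 2 * (∫ x, M x ^ 2 ∂ν) / 2 + t * ∫ x, L x * M x ∂ν) := by
    intro t
    have h1 : ∫ x, Real.exp (L x) * Real.exp (t * M x) ∂ν
        = Real.exp ((∫ x, ((1 : ℝ) • L + t • M) x ^ 2 ∂ν) / 2) := by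
      rw [← integral_exp_dual hν]
      refine integral_congr_ae (ae_of_all _ fun x => ?_)
      simp [Real.exp_add]
    rw [mgf, integral_tilted]
    simp_rw [smul_eq_mul, div_mul_eq_mul_div]
    rw [integral_div, h1, integral_exp_dual hν, ← Real.exp_sub, integral_sq_add_smul]
    congr 1
    ring
  have hmgf' : ∀ t, mgf M (ν.map fun x => x + covarianceVector ν L) t =
      Real.exp (t ^ 2 * (∫ x, M x ^ 2 ∂ν) / 2 + t * ∫ x, L x * M x ∂ν) := by
    intro t
    rw [mgf, integral_map (by fun_prop) (by fun_prop)]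
    simp_rw [map_add, mul_add, Real.exp_add, dual_covarianceVector]
    rw [integral_mul_const, ← mgf, mgf_dual hν]
  have heq : mgf M (ν.tilted L) = mgf M (ν.map fun x => x + covarianceVector ν L) := by
    ext t; rw [hmgf, hmgf']
  symm
  refine eqOn_complexMGF_of_mgf heq ?_
  have huniv : integrableExpSet M (ν.tilted L) = Set.univ := by
    ext t
    have : 0 < mgf M (ν.tilted L) t := by rw [hmgf]; exact Real.exp_pos _
    simpa [integrableExpSet] using mgf_pos_iff.1 this
  simp [huniv]

theorem measure_ball_sub_covarianceVector (hν : ∀ L : StrongDual ℝ B, ∫ x, L x ∂ν = 0)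
    (L : StrongDual ℝ B) (z : B) (r : ℝ) :
    ν (Metric.ball (z - covarianceVector ν L) r)
      = ∫⁻ x in Metric.ball z r, ENNReal.ofReal (Real.exp (L x - (∫ x, L x ^ 2 ∂ν) / 2)) ∂ν := by
  have h := congrArg (fun m => m (Metric.ball z r)) (map_add_covarianceVector hν L)
  rw [Measure.map_apply (by fun_prop) Metric.isOpen_ball.measurableSet, tilted_apply,
    integral_exp_dual hν] at h
  simp_rw [Real.exp_sub]
  rw [← h]
  congr 1
  ext x
  simp [dist_eq_norm, sub_sub_eq_add_sub]

/-- The measure of a small ball is bounded by that of the ball centered at the origin: the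
translation by `covarianceVector ν L` has a density which is nearly constant on the ball, and
Anderson's inequality bounds the measure of the translated ball. -/
theorem measure_ball_le_exp_mul (hν : ∀ L : StrongDual ℝ B, ∫ x, L x ∂ν = 0)
    (L : StrongDual ℝ B) (z : B) (r : ℝ) :
    ν (Metric.ball z r)
      ≤ ENNReal.ofReal (Real.exp (-L z + ‖L‖ * r + (∫ x, L x ^ 2 ∂ν) / 2))
        * ν (Metric.ball 0 r) := by
  set s := ∫ x, L x ^ 2 ∂ν with hs
  have h1 : ENNReal.ofReal (Real.exp (-(-L z + ‖L‖ * r + s / 2))) * ν (Metric.ball z r)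
      ≤ ν (Metric.ball 0 r) := by
    refine le_trans ?_ (measure_ball_le hν (z - covarianceVector ν L) r)
    rw [measure_ball_sub_covarianceVector hν, ← setLIntegral_const]
    refine setLIntegral_mono' Metric.isOpen_ball.measurableSet fun x hx => ?_
    refine ENNReal.ofReal_le_ofReal (Real.exp_le_exp.2 ?_)
    have h2 : |L (x - z)| ≤ ‖L‖ * r := by
      refine (L.le_opNorm (x - z)).trans (mul_le_mul_of_nonneg_left ?_ (norm_nonneg _))
      exact (mem_ball_iff_norm.1 hx).le
    rw [map_sub] at h2
    have := abs_le.1 h2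
    linarith
  calc ν (Metric.ball z r)
      = ENNReal.ofReal (Real.exp (-L z + ‖L‖ * r + s / 2)) *
        (ENNReal.ofReal (Real.exp (-(-L z + ‖L‖ * r + s / 2))) * ν (Metric.ball z r)) := by
        rw [← mul_assoc, ← ENNReal.ofReal_mul (Real.exp_pos _).le, ← Real.exp_add]
        simp
    _ ≤ _ := by gcongr

/-- By symmetry the density of the translated measure may be replaced on the ball by a hyperbolic
cosine, which is at least `1`. -/
theorem exp_mul_measure_ball_le_covarianceVector (hν : ∀ L : StrongDual ℝ B, ∫ x, L x ∂ν = 0)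
    (L : StrongDual ℝ B) (r : ℝ) :
    ENNReal.ofReal (Real.exp (-(∫ x, L x ^ 2 ∂ν) / 2)) * ν (Metric.ball 0 r)
      ≤ ν (Metric.ball (covarianceVector ν L) r) := by
  set s := ∫ x, L x ^ 2 ∂ν with hs
  have hU : MeasurableSet (Metric.ball (0 : B) r) := Metric.isOpen_ball.measurableSet
  have hpre : (fun x : B => -x) ⁻¹' Metric.ball 0 r = Metric.ball 0 r := by ext; simp
  have h1 : ν (Metric.ball (covarianceVector ν L) r)
      = ∫⁻ x in Metric.ball 0 r, ENNReal.ofReal (Real.exp (L x - s / 2)) ∂ν := by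
    rw [← measure_ball_sub_covarianceVector hν, zero_sub,
      ← measure_preimage_neg_eq (map_neg_eq_self hν) Metric.isOpen_ball.measurableSet]
    congr 1
    ext x
    simp [dist_eq_norm, ← norm_neg (x + covarianceVector ν L), sub_eq_add_neg, add_comm]
  have h2 : ∫⁻ x in Metric.ball 0 r, ENNReal.ofReal (Real.exp (L x - s / 2)) ∂ν
      = ∫⁻ x in Metric.ball 0 r, ENNReal.ofReal (Real.exp (-L x - s / 2)) ∂ν := by
    conv_lhs => rw [← map_neg_eq_self hν]
    rw [setLIntegral_map hU (by fun_prop) (by fun_prop), hpre]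
    simp
  have h3 : 2 * (ENNReal.ofReal (Real.exp (-s / 2)) * ν (Metric.ball 0 r))
      ≤ 2 * ν (Metric.ball (covarianceVector ν L) r) := by
    rw [two_mul (ν (Metric.ball (covarianceVector ν L) r))]
    nth_rw 2 [h1]
    rw [h2, h1, ← lintegral_add_left (by fun_prop), ← mul_assoc, ← setLIntegral_const]
    refine setLIntegral_mono' hU fun x _ => ?_
    rw [← ENNReal.ofReal_add (Real.exp_pos _).le (Real.exp_pos _).le,
      show (2 : ℝ≥0∞) = ENNReal.ofReal 2 by simp, ← ENNReal.ofReal_mul (by norm_num)]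
    refine ENNReal.ofReal_le_ofReal ?_
    have := Real.one_le_cosh (L x)
    rw [Real.cosh_eq] at this
    rw [sub_eq_add_neg, sub_eq_add_neg, Real.exp_add, Real.exp_add, neg_div]
    have := Real.exp_pos (-(s / 2))
    nlinarith
  exact (ENNReal.mul_le_mul_iff_right (by simp) (by simp)).1 h3

/-! ### A lower bound for the measure of balls centered in the Cameron–Martin space -/

/-- The covariance vectors `covarianceVector ν L` of Cameron–Martin norm at most `c` are dense, for
the norm of `B`, in the ball of radius `c` of the Cameron–Martin space. Otherwise the Hahn–Banach
theorem would give a functional `M` which is larger at `z` than `c * √(∫ M ^ 2)`. -/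
theorem mem_closure_covarianceVector {z : B} {c : ℝ} (hc : 0 ≤ c)
    (hz : cameronMartinNorm ν z ≤ ENNReal.ofReal c) :
    z ∈ closure (covarianceVector ν '' {L | ∫ x, L x ^ 2 ∂ν ≤ c ^ 2}) := by
  by_contra hmem
  have hconv : Convex ℝ (covarianceVector ν '' {L | ∫ x, L x ^ 2 ∂ν ≤ c ^ 2}) := by
    rintro _ ⟨L, hL, rfl⟩ _ ⟨M, hM, rfl⟩ a b ha hb hab
    refine ⟨a • L + b • M, ?_, covarianceVector_add_smul a b L M⟩
    have hnn : 0 ≤ ∫ x, ((1 : ℝ) • L + (-1 : ℝ) • M) x ^ 2 ∂ν :=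
      integral_nonneg fun x => sq_nonneg _
    simp only [Set.mem_ofPred_eq] at hL hM ⊢
    rw [integral_sq_add_smul] at hnn ⊢
    have hb' : b = 1 - a := by linarith
    subst hb'
    nlinarith [mul_nonneg ha hb]
  obtain ⟨M, u, hMu, huz⟩ := geometric_hahn_banach_closed_point hconv.closure isClosed_closure hmem
  set s := ∫ x, M x ^ 2 ∂ν with hs
  have hs0 : 0 ≤ s := integral_nonneg fun x => sq_nonneg _
  have hMz := abs_le.1 (abs_dual_le_of_cameronMartinNorm_le hc hz M)
  rw [← hs] at hMz
  -- the functional in the set at which `M` is greatest; for `s = 0` it is zero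
  have hk : ∫ x, ((c / √s) • M) x ^ 2 ∂ν = (c / √s) ^ 2 * s := by
    rw [hs, ← integral_const_mul]
    simp [mul_pow]
  have h1 := hMu _ (subset_closure ⟨(c / √s) • M, by
    simp only [Set.mem_ofPred_eq]
    rw [hk, div_pow, Real.sq_sqrt hs0]
    rcases hs0.eq_or_lt with h0 | h0
    · rw [← h0]; simp; positivity
    · rw [div_mul_cancel₀ _ h0.ne'], rfl⟩)
  have h2 : M (covarianceVector ν ((c / √s) • M)) = c * √s := by
    rw [dual_covarianceVector]
    have : ∫ x, ((c / √s) • M) x * M x ∂ν = (c / √s) * s := by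
      rw [hs, ← integral_const_mul]
      refine integral_congr_ae (ae_of_all _ fun x => ?_)
      simp
      ring
    rw [this, div_mul_eq_mul_div, mul_div_assoc, Real.div_sqrt]
  linarith

/-- The lower bound for covariance vectors extends to all vectors of finite Cameron–Martin norm, by
approximation in the norm of `B`. -/
theorem exp_mul_measure_ball_le (hν : ∀ L : StrongDual ℝ B, ∫ x, L x ∂ν = 0) {z : B} {c : ℝ}
    (hc : 0 ≤ c) (hz : cameronMartinNorm ν z ≤ ENNReal.ofReal c) (r : ℝ) :
    ENNReal.ofReal (Real.exp (-c ^ 2 / 2)) * ν (Metric.ball 0 r) ≤ ν (Metric.ball z r) := by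
  have hU : Metric.ball (0 : B) r = ⋃ n : ℕ, Metric.ball 0 (r - 1 / ((n : ℝ) + 1)) := by
    ext x
    simp only [Metric.mem_ball, Set.mem_iUnion]
    constructor
    · intro h
      obtain ⟨n, hn⟩ := exists_nat_one_div_lt (sub_pos.2 h)
      exact ⟨n, by linarith⟩
    · rintro ⟨n, hn⟩
      have : (0 : ℝ) < 1 / ((n : ℝ) + 1) := by positivity
      linarith
  have hmono : Monotone fun n : ℕ => Metric.ball (0 : B) (r - 1 / ((n : ℝ) + 1)) :=
    fun m n h => Metric.ball_subset_ball (sub_le_sub_left (Nat.one_div_le_one_div h) r)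
  rw [hU, hmono.measure_iUnion, ENNReal.mul_iSup]
  refine iSup_le fun n => ?_
  obtain ⟨_, ⟨L, hL, rfl⟩, hd⟩ := Metric.mem_closure_iff.1 (mem_closure_covarianceVector hc hz)
    (1 / ((n : ℝ) + 1)) (by positivity)
  calc ENNReal.ofReal (Real.exp (-c ^ 2 / 2)) * ν (Metric.ball 0 (r - 1 / ((n : ℝ) + 1)))
      ≤ ENNReal.ofReal (Real.exp (-(∫ x, L x ^ 2 ∂ν) / 2))
          * ν (Metric.ball 0 (r - 1 / ((n : ℝ) + 1))) := by
        gcongr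
        exact hL
    _ ≤ ν (Metric.ball (covarianceVector ν L) (r - 1 / ((n : ℝ) + 1))) :=
        exp_mul_measure_ball_le_covarianceVector hν L _
    _ ≤ ν (Metric.ball z r) := measure_mono (Metric.ball_subset_ball' (by
        rw [dist_comm]; linarith))

end

/-! ### Small ball asymptotics of a Gaussian measure -/

/-- The bounds given by single functionals combine to the bound given by the Cameron–Martin norm. A
positive bound `a` forces this norm to be finite. -/
theorem ne_top_and_le_exp_cameronMartinNorm {B : Type*} [NormedAddCommGroup B] [NormedSpace ℝ B]
    [MeasurableSpace B] [BorelSpace B] {ν : Measure B} [IsGaussian ν] {z : B} {a : ℝ≥0∞}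
    (ha : a ≠ 0) (h : ∀ L : StrongDual ℝ B, ∫ x, L x ^ 2 ∂ν ≤ 1 →
      a ≤ ENNReal.ofReal (Real.exp (-(L z) ^ 2 / 2))) :
    cameronMartinNorm ν z ≠ ⊤ ∧
      a ≤ ENNReal.ofReal (Real.exp (-(cameronMartinNorm ν z).toReal ^ 2 / 2)) := by
  have ha1 : a ≤ 1 := by simpa using h 0 (by simp)
  have hatop : a ≠ ⊤ := (ha1.trans_lt ENNReal.one_lt_top).ne
  have hapos : 0 < a.toReal := ENNReal.toReal_pos ha hatop
  have hlog : Real.log a.toReal ≤ 0 :=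
    Real.log_nonpos hapos.le (ENNReal.toReal_le_of_le_ofReal zero_le_one (by simpa using ha1))
  have hle : cameronMartinNorm ν z ≤ ENNReal.ofReal √(-2 * Real.log a.toReal) := by
    rw [cameronMartinNorm_le_ofReal_iff (Real.sqrt_nonneg _)]
    intro L hL
    refine Real.abs_le_sqrt ?_
    have h1 := (ENNReal.le_ofReal_iff_toReal_le hatop (Real.exp_pos _).le).1 (h L hL)
    have h2 := (Real.log_le_iff_le_exp hapos).2 h1
    linarith
  have htop : cameronMartinNorm ν z ≠ ⊤ := (hle.trans_lt ENNReal.ofReal_lt_top).ne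
  refine ⟨htop, ?_⟩
  have h1 := (ENNReal.le_ofReal_iff_toReal_le htop (Real.sqrt_nonneg _)).1 hle
  rw [ENNReal.le_ofReal_iff_toReal_le hatop (Real.exp_pos _).le, ← Real.log_le_iff_le_exp hapos]
  have h3 := pow_le_pow_left₀ ENNReal.toReal_nonneg h1 2
  rw [Real.sq_sqrt (by linarith)] at h3
  linarith

section

variable {B : Type*} [NormedAddCommGroup B] [NormedSpace ℝ B] [CompleteSpace B]
  [TopologicalSpace.SeparableSpace B] [MeasurableSpace B] [BorelSpace B]
  {ν : Measure B} [IsGaussian ν]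

theorem eventually_measure_ball_div_lt (hν : ∀ L : StrongDual ℝ B, ∫ x, L x ∂ν = 0) (z : B)
    {L : StrongDual ℝ B} (hL : ∫ x, L x ^ 2 ∂ν ≤ 1) {a : ℝ≥0∞}
    (ha : ENNReal.ofReal (Real.exp (-(L z) ^ 2 / 2)) < a) :
    ∀ᶠ r in 𝓝[>] (0 : ℝ), ν (Metric.ball z r) / ν (Metric.ball 0 r) < a := by
  have hlim : Tendsto (fun r : ℝ => ENNReal.ofReal
      (Real.exp (-(L z) ^ 2 / 2 + ‖(L z) • L‖ * r))) (𝓝[>] 0)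
      (𝓝 (ENNReal.ofReal (Real.exp (-(L z) ^ 2 / 2 + ‖(L z) • L‖ * 0)))) := by
    refine Tendsto.mono_left (Continuous.tendsto ?_ 0) nhdsWithin_le_nhds
    exact ENNReal.continuous_ofReal.comp (by fun_prop)
  rw [mul_zero, add_zero] at hlim
  filter_upwards [hlim.eventually_lt_const ha] with r hr
  refine lt_of_le_of_lt (ENNReal.div_le_of_le_mul ?_) hr
  -- the multiple of `L` for which the exponent is least, if `L` has variance one
  refine (measure_ball_le_exp_mul hν ((L z) • L) z r).trans ?_
  have h1 : ∫ x, ((L z) • L) x ^ 2 ∂ν = (L z) ^ 2 * ∫ x, L x ^ 2 ∂ν := by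
    rw [← integral_const_mul]
    simp [mul_pow]
  rw [h1]
  refine mul_le_mul_left (ENNReal.ofReal_le_ofReal (Real.exp_le_exp.2 ?_)) _
  simp only [FunLike.coe_smul, Pi.smul_apply, smul_eq_mul]
  nlinarith [mul_le_mul_of_nonneg_left hL (sq_nonneg (L z))]

theorem tendsto_measure_ball_div (hν : ∀ L : StrongDual ℝ B, ∫ x, L x ∂ν = 0) {z : B}
    (hz : cameronMartinNorm ν z ≠ ⊤) :
    Tendsto (fun r : ℝ => ν (Metric.ball z r) / ν (Metric.ball 0 r)) (𝓝[>] 0)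
      (𝓝 (ENNReal.ofReal (Real.exp (-(cameronMartinNorm ν z).toReal ^ 2 / 2)))) := by
  refine tendsto_order.2 ⟨fun a ha => ?_, fun a ha => ?_⟩
  · filter_upwards [self_mem_nhdsWithin] with r (hr : 0 < r)
    refine ha.trans_le ((ENNReal.le_div_iff_mul_le (Or.inl (measure_ball_zero_pos hν hr).ne')
      (Or.inl (measure_ne_top _ _))).2 ?_)
    exact exp_mul_measure_ball_le hν ENNReal.toReal_nonneg (by rw [ENNReal.ofReal_toReal hz]) r
  · by_contra hcon
    refine absurd (ne_top_and_le_exp_cameronMartinNorm (ν := ν) (z := z)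
      (pos_of_gt ha).ne' fun L hL => ?_).2 (not_le.2 ha)
    by_contra! hlt
    exact hcon (eventually_measure_ball_div_lt hν z hL hlt)

theorem tendsto_measure_ball_div_zero (hν : ∀ L : StrongDual ℝ B, ∫ x, L x ∂ν = 0) {z : B}
    (hz : cameronMartinNorm ν z = ⊤) :
    Tendsto (fun r : ℝ => ν (Metric.ball z r) / ν (Metric.ball 0 r)) (𝓝[>] 0) (𝓝 0) := by
  refine tendsto_order.2 ⟨fun a ha => absurd ha not_lt_zero, fun a ha => ?_⟩
  by_contra hcon
  refine (ne_top_and_le_exp_cameronMartinNorm (ν := ν) (z := z) ha.ne' fun L hL => ?_).1 hz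
  by_contra! hlt
  exact hcon (eventually_measure_ball_div_lt hν z hL hlt)

end

/-! ### Onsager–Machlup functions of measures with a continuous density -/

theorem tendsto_setLIntegral_ball_div {X : Type*} [PseudoMetricSpace X] [MeasurableSpace X]
    [OpensMeasurableSpace X] {ν : Measure X} {φ : X → ℝ≥0∞} {z : X} (hφ : ContinuousAt φ z)
    (hφz : φ z ≠ ⊤) {d : ℝ → ℝ≥0∞} {q : ℝ≥0∞} (hq : q ≠ ⊤)
    (h : Tendsto (fun r => ν (Metric.ball z r) / d r) (𝓝[>] 0) (𝓝 q)) :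
    Tendsto (fun r => (∫⁻ x in Metric.ball z r, φ x ∂ν) / d r) (𝓝[>] 0) (𝓝 (φ z * q)) := by
  have hball : ∀ {p : X → Prop}, (∀ᶠ x in 𝓝 z, p x) →
      ∀ᶠ r in 𝓝[>] (0 : ℝ), ∀ x ∈ Metric.ball z r, p x := by
    intro p hp
    obtain ⟨δ, hδ, hsub⟩ := Metric.eventually_nhds_iff_ball.1 hp
    filter_upwards [Ioo_mem_nhdsGT hδ] with r hr x hx
    exact hsub x (Metric.ball_subset_ball hr.2.le hx)
  have hinf : Tendsto (fun r => ⨅ x ∈ Metric.ball z r, φ x) (𝓝[>] 0) (𝓝 (φ z)) := by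
    refine tendsto_order.2 ⟨fun a ha => ?_, fun a ha => ?_⟩
    · obtain ⟨b, hab, hb⟩ := exists_between ha
      filter_upwards [hball (hφ.eventually_const_lt hb)] with r hr
      exact hab.trans_le (le_iInf₂ fun x hx => (hr x hx).le)
    · filter_upwards [self_mem_nhdsWithin] with r hr
      exact (iInf₂_le z (Metric.mem_ball_self hr)).trans_lt ha
  have hsup : Tendsto (fun r => ⨆ x ∈ Metric.ball z r, φ x) (𝓝[>] 0) (𝓝 (φ z)) := by
    refine tendsto_order.2 ⟨fun a ha => ?_, fun a ha => ?_⟩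
    · filter_upwards [self_mem_nhdsWithin] with r hr
      exact ha.trans_le (le_iSup₂ (f := fun x (_ : x ∈ Metric.ball z r) => φ x) z
        (Metric.mem_ball_self hr))
    · obtain ⟨b, hb, hab⟩ := exists_between ha
      filter_upwards [hball (hφ.eventually_lt_const hb)] with r hr
      exact (iSup₂_le fun x hx => (hr x hx).le).trans_lt hab
  refine tendsto_of_tendsto_of_tendsto_of_le_of_le
    (ENNReal.Tendsto.mul hinf (Or.inr hq) h (Or.inr hφz))
    (ENNReal.Tendsto.mul hsup (Or.inr hq) h (Or.inr hφz)) (fun r => ?_) (fun r => ?_)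
  · simp only
    rw [← mul_div_assoc]
    refine ENNReal.div_le_div_right ?_ _
    rw [← setLIntegral_const]
    exact setLIntegral_mono' Metric.isOpen_ball.measurableSet fun x hx => iInf₂_le x hx
  · simp only
    rw [← mul_div_assoc]
    refine ENNReal.div_le_div_right ?_ _
    rw [← setLIntegral_const]
    exact setLIntegral_mono' Metric.isOpen_ball.measurableSet fun x hx =>
      le_iSup₂ (f := fun x (_ : x ∈ Metric.ball z r) => φ x) x hx

/-- It is enough to compare the measures of the balls with a normalization `d r` which does not
depend on the center. -/
theorem isOnsagerMachlup_extendTop {X : Type*} [PseudoMetricSpace X] [MeasurableSpace X]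
    {μ : Measure X} {S : Set X} (hS : S.Nonempty) {f : X → ℝ} {d : ℝ → ℝ≥0∞}
    (hd : ∀ r > 0, d r ≠ 0) (hd' : ∀ r > 0, d r ≠ ⊤) {K : ℝ} (hK : 0 < K)
    (hin : ∀ z ∈ S, Tendsto (fun r => μ (Metric.ball z r) / d r) (𝓝[>] 0)
      (𝓝 (ENNReal.ofReal (Real.exp (-f z) / K))))
    (hout : ∀ z ∉ S, Tendsto (fun r => μ (Metric.ball z r) / d r) (𝓝[>] 0) (𝓝 0)) :
    IsOnsagerMachlup μ (extendTop S f) := by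
  refine ⟨?_, fun z₁ z₂ h _ => ?_⟩
  · obtain ⟨z, hz⟩ := hS
    exact ⟨z, by simp [extendTop, hz], by simp [extendTop, hz]⟩
  have hdiv : ∀ {a b : ℝ≥0∞}, Tendsto (fun r => μ (Metric.ball z₁ r) / d r) (𝓝[>] 0) (𝓝 a) →
      Tendsto (fun r => μ (Metric.ball z₂ r) / d r) (𝓝[>] 0) (𝓝 b) → (a ≠ 0 ∨ b ≠ 0) →
      a ≠ ⊤ → Tendsto (fun r => μ (Metric.ball z₁ r) / μ (Metric.ball z₂ r)) (𝓝[>] 0)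
        (𝓝 (a / b)) := by
    intro a b ha hb h0 htop
    refine (ENNReal.Tendsto.div ha h0 hb (Or.inr htop)).congr' ?_
    filter_upwards [self_mem_nhdsWithin] with r hr
    simp only [div_eq_mul_inv (_ : ℝ≥0∞) (d r)]
    exact ENNReal.mul_div_mul_right _ _ (ENNReal.inv_ne_zero.2 (hd' r hr))
      (ENNReal.inv_ne_top.2 (hd r hr))
  have hpos : ∀ z, ENNReal.ofReal (Real.exp (-f z) / K) ≠ 0 := fun z => by
    simp only [ne_eq, ENNReal.ofReal_eq_zero, not_le]; positivity
  by_cases h1 : z₁ ∈ S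
  · by_cases h2 : z₂ ∈ S
    · have := hdiv (hin z₁ h1) (hin z₂ h2) (Or.inl (hpos _)) ENNReal.ofReal_ne_top
      convert this using 2
      rw [← ENNReal.ofReal_div_of_pos (by positivity), div_div_div_cancel_right₀ hK.ne',
        ← Real.exp_sub]
      simp only [extendTop, h1, h2, if_true, ← EReal.coe_sub, EReal.exp_coe]
      congr 2
      ring
    · have := hdiv (hin z₁ h1) (hout z₂ h2) (Or.inl (hpos _)) ENNReal.ofReal_ne_top
      convert this using 2
      rw [ENNReal.div_zero (hpos _)]
      simp [extendTop, h1, h2]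
  · by_cases h2 : z₂ ∈ S
    · have := hdiv (hout z₁ h1) (hin z₂ h2) (Or.inr (hpos _)) ENNReal.zero_ne_top
      convert this using 2
      simp [extendTop, h1, h2]
    · exact absurd ⟨by simp [extendTop, h1], by simp [extendTop, h2]⟩ h

/-! ### Scaling -/

section

variable {B : Type*} [NormedAddCommGroup B] [NormedSpace ℝ B] [MeasurableSpace B] [BorelSpace B]

theorem isGaussian_scaledMeasure (μ₀ : Measure B) [IsGaussian μ₀] (ε : ℝ) :
    IsGaussian (scaledMeasure μ₀ ε) := by
  have : scaledMeasure μ₀ ε = μ₀.map (ε • ContinuousLinearMap.id ℝ B) := rfl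
  rw [this]
  infer_instance

theorem integral_dual_scaledMeasure {μ₀ : Measure B}
    (hcentered : ∀ L : StrongDual ℝ B, ∫ x, L x ∂μ₀ = 0) (ε : ℝ) (L : StrongDual ℝ B) :
    ∫ x, L x ∂(scaledMeasure μ₀ ε) = 0 := by
  rw [scaledMeasure, integral_map (by fun_prop) (by fun_prop)]
  simp [integral_const_mul, hcentered]

theorem enorm_mul_cameronMartinNorm_scaledMeasure (μ₀ : Measure B) {ε : ℝ} (hε : ε ≠ 0) (z : B) :
    ‖ε‖ₑ * cameronMartinNorm (scaledMeasure μ₀ ε) z = cameronMartinNorm μ₀ z := by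
  simp only [cameronMartinNorm, ENNReal.mul_iSup]
  refine Function.Surjective.iSup_congr (fun L : StrongDual ℝ B => ε • L)
    (fun L => ⟨ε⁻¹ • L, smul_inv_smul₀ hε L⟩) fun L => ?_
  have h1 : ∫⁻ x, ‖L x‖ₑ ^ 2 ∂(scaledMeasure μ₀ ε) = ∫⁻ x, ‖(ε • L) x‖ₑ ^ 2 ∂μ₀ := by
    rw [scaledMeasure, lintegral_map (by fun_prop) (by fun_prop)]
    simp
  have h2 : ‖(ε • L) z‖ₑ = ‖ε‖ₑ * ‖L z‖ₑ := by simp [enorm_mul]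
  rw [h1, h2]

end

theorem mainTheorem4 {B : Type*} [NormedAddCommGroup B] [NormedSpace ℝ B] [CompleteSpace B]
    [TopologicalSpace.SeparableSpace B] [MeasurableSpace B] [BorelSpace B]
    (μ₀ : Measure B) [IsGaussian μ₀] (hcentered : ∀ L : StrongDual ℝ B, ∫ x, L x ∂μ₀ = 0)
    (n : ℕ) (F : ℝ → B → ℝ) (Fc : ℕ → B → ℝ) (R : ℝ → B → ℝ)
    (hFc_meas : ∀ i ≤ n, Measurable (Fc i)) (hR_meas : ∀ ε > 0, Measurable (R ε))
    (hexpansion : ∀ ε > 0, ∀ y, F ε y =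
      (∑ i ∈ Finset.range (n + 1), ε ^ i / (i.factorial : ℝ) * Fc i y) + ε ^ n * R ε y)
    (hR : ∀ y, Tendsto (fun ε => R ε y) (𝓝[>] 0) (𝓝 0))
    (hF₀ : Continuous (Fc 0))
    (hmoment : ∀ i ≤ n, ∃ γ > 0, ExpMomentBound μ₀ γ (Fc i) R)
    (ε : ℝ) (hε : 0 < ε) (hF_cont : Continuous (F ε))
    (hnormalizable : Integrable (fun y => Real.exp (-(F ε y / ε ^ 2))) (scaledMeasure μ₀ ε)) :
    IsOnsagerMachlup ((scaledMeasure μ₀ ε).tilted (fun y => -(F ε y / ε ^ 2)))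
      (extendTop (cameronMartinSpace μ₀)
        (fun z => F ε z / ε ^ 2 + (cameronMartinNorm μ₀ z).toReal ^ 2 / (2 * ε ^ 2))) := by
  have hgauss := isGaussian_scaledMeasure μ₀ ε
  have hν := integral_dual_scaledMeasure hcentered ε
  have hscale := enorm_mul_cameronMartinNorm_scaledMeasure μ₀ hε.ne'
  set ν := scaledMeasure μ₀ ε with hνdef
  have hZ : 0 < ∫ y, Real.exp (-(F ε y / ε ^ 2)) ∂ν := integral_exp_pos hnormalizable
  set Z := ∫ y, Real.exp (-(F ε y / ε ^ 2)) ∂ν with hZdef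
  have hball : ∀ (z : B) (r : ℝ), ν.tilted (fun y => -(F ε y / ε ^ 2)) (Metric.ball z r)
      = ∫⁻ y in Metric.ball z r, ENNReal.ofReal (Real.exp (-(F ε y / ε ^ 2)) / Z) ∂ν :=
    fun z r => tilted_apply _ _ _
  have hcont : Continuous fun y => ENNReal.ofReal (Real.exp (-(F ε y / ε ^ 2)) / Z) :=
    ENNReal.continuous_ofReal.comp (by fun_prop)
  refine isOnsagerMachlup_extendTop ⟨0, by simp [cameronMartinSpace, cameronMartinNorm]⟩
    (d := fun r => ν (Metric.ball 0 r)) (fun r hr => (measure_ball_zero_pos hν hr).ne')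
    (fun r _ => measure_ne_top _ _) hZ (fun z hz => ?_) (fun z hz => ?_)
  · have hz' : cameronMartinNorm ν z ≠ ⊤ := by
      intro h
      have := hscale z
      rw [h, ENNReal.mul_top (by simpa using hε.ne')] at this
      exact (ne_of_lt hz) this.symm
    have hnorm : (cameronMartinNorm μ₀ z).toReal = ε * (cameronMartinNorm ν z).toReal := by
      rw [← hscale z, ENNReal.toReal_mul]
      simp [abs_of_pos hε]
    simp_rw [hball]
    convert tendsto_setLIntegral_ball_div hcont.continuousAt ENNReal.ofReal_ne_top
      ENNReal.ofReal_ne_top (tendsto_measure_ball_div hν hz') using 2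
    rw [← ENNReal.ofReal_mul (by positivity), div_mul_eq_mul_div, ← Real.exp_add, hnorm]
    congr 3
    field_simp
    ring
  · have hz' : cameronMartinNorm ν z = ⊤ := by
      by_contra h
      refine hz ?_
      have : cameronMartinNorm μ₀ z < ⊤ := by
        rw [← hscale z]
        exact ENNReal.mul_lt_top (by simp) (lt_top_iff_ne_top.2 h)
      exact this
    simp_rw [hball]
    simpa using tendsto_setLIntegral_ball_div hcont.continuousAt ENNReal.ofReal_ne_top
      ENNReal.zero_ne_top (tendsto_measure_ball_div_zero hν hz')
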